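/- **Theorem (iterative feature matching for approximate ranking).** For each $p\ge 2$ write $[p]=\{1,\dots,p\}$, let $\beta^*=\beta^*_p\in\mathbb{R}$, and let $$\mathcal{R}=\mathcal{R}_p=\Big\{z\in[p]^p:\ \min_{\widetilde z}\|z-\widetilde z\|^2\le c_p\Big\},$$ where the minimum is over all permutations $\widetilde z$ of $(1,\dots,p)$ and $1\le c_p=o(p)$. For $z^*\in[p]^p$ one observes $Y_{ij}\sim\mathcal{N}(\beta^*(z_i^*-z_j^*),1)$, independently over all ordered pairs $1\le i\ne j\le p$. The loss is $$\ell(z,z^*)=\frac{2p^2(\beta^*)^2}{p-1}\sum_{j=1}^p(z_j-z_j^*)^2 .$$ Starting from a (random) initialization $z^{(0)}\in[p]^p$, iterative feature matching computes, for $t\ge1$, $$z^{(t)}_j\in\mathop{\rm argmin}_{a\in[p]}\Big|\sum_{i\ne j}(Y_{ji}-Y_{ij})-2p\,\widehat\beta(z^{(t-1)})\Big(a-\frac{p+1}{2}\Big)\Big|^2,\quad j\in[p],\qquad \widehat\beta(z)=\frac{\sum_{i\ne j}(z_i-z_j)Y_{ij}}{\sum_{i\ne j}(z_i-z_j)^2},$$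 with the convention $0/0=0$ and ties broken arbitrarily. Assume $p(\beta^*)^2\to\infty$ as $p\to\infty$ and $z^*\in\mathcal{R}$, and suppose that, for some sequence $\tau_p=o(p^2(\beta^*)^2)$, $\ell(z^{(0)},z^*)\le\tau_p$ with probability at least $1-\eta$. Then $$\ell(z^{(t)},z^*)\le p\exp\Big(-(1+o(1))\frac{p(\beta^*)^2}{4}\Big)+\frac12\,\ell(z^{(t-1)},z^*)\quad\text{for all }t\ge1\text{ simultaneously}$$ with probability at least $1-\eta-\exp\big(-\sqrt{p(\beta^*)^2}\big)-2p^{-1}$. Here $o(1)$ is a deterministic sequence converging to $0$ as $p\to\infty$ that depends only on the sequences $(\beta^*_p)$, $(c_p)$ and $(\tau_p)$. -/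

import Mathlib

open MeasureTheory ProbabilityTheory Filter Topology Asymptotics

namespace ApproxRanking

/-- Label vectors `z ∈ [p]^p`, where `[p] = {1, …, p}`; player `j` is an element of `Fin p`. -/
def IsLabel {p : ℕ} (z : Fin p → ℕ) : Prop :=
  ∀ j, z j ∈ Finset.Icc 1 p

/-- The class `𝓡` of approximate permutations: the vectors `z ∈ [p]^p` with
`min_{z̃} ‖z - z̃‖² ≤ c`, the minimum being over all permutations `z̃` of `{1, …, p}`.
The permutation `σ` of `Fin p` stands for the vector `z̃ j = σ j + 1`. -/
def approxPerm (p : ℕ) (c : ℝ) : Set (Fin p → ℕ) :=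
  {z | IsLabel z ∧
    ∃ σ : Equiv.Perm (Fin p), ∑ j, ((z j : ℝ) - (((σ j : ℕ) : ℝ) + 1)) ^ 2 ≤ c}

/-- The pairwise comparison model: `Y i j ∼ N(b (z*_i - z*_j), 1)`, independently over all
ordered pairs `i ≠ j`. The diagonal entries `Y i i` are not part of the data. -/
structure IsPairwiseComparison {p : ℕ} {Ω : Type*} [MeasurableSpace Ω] (P : Measure Ω)
    (b : ℝ) (zstar : Fin p → ℕ) (Y : Fin p → Fin p → Ω → ℝ) : Prop where
  hasLaw : ∀ i j, i ≠ j →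
    HasLaw (Y i j) (gaussianReal (b * ((zstar i : ℝ) - (zstar j : ℝ))) 1) P
  indep : iIndepFun (fun ij : {ij : Fin p × Fin p // ij.1 ≠ ij.2} => Y ij.1.1 ij.1.2) P

/-- The loss `ℓ(z, z*) = (2 p² b² / (p - 1)) ∑_j (z_j - z*_j)²`. -/
noncomputable def loss {p : ℕ} (b : ℝ) (z zstar : Fin p → ℕ) : ℝ :=
  2 * (p : ℝ) ^ 2 * b ^ 2 / ((p : ℝ) - 1) * ∑ j, ((z j : ℝ) - (zstar j : ℝ)) ^ 2

/-- The least-squares estimator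
`β̂(z) = ∑_{i ≠ j} (z_i - z_j) y_{ij} / ∑_{i ≠ j} (z_i - z_j)²` (with `0 / 0 = 0`). -/
noncomputable def betaHat {p : ℕ} (y : Fin p → Fin p → ℝ) (z : Fin p → ℕ) : ℝ :=
  (∑ i, ∑ j ∈ Finset.univ.erase i, ((z i : ℝ) - (z j : ℝ)) * y i j) /
    ∑ i, ∑ j ∈ Finset.univ.erase i, ((z i : ℝ) - (z j : ℝ)) ^ 2

/-- The feature matching criterion
`|∑_{i ≠ j} (y_{ji} - y_{ij}) - 2 p β̂(z) (a - (p + 1) / 2)|²` of position `a` for player `j`. -/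
noncomputable def criterion {p : ℕ} (y : Fin p → Fin p → ℝ) (z : Fin p → ℕ) (j : Fin p)
    (a : ℕ) : ℝ :=
  |∑ i ∈ Finset.univ.erase j, (y j i - y i j)
    - 2 * (p : ℝ) * betaHat y z * ((a : ℝ) - ((p : ℝ) + 1) / 2)| ^ 2

/-- `z'` results from `z` by one iteration of feature matching: for every `j`, the position `z' j`
minimizes the criterion over `[p]` (ties may be broken in any way). -/
def IsStep {p : ℕ} (y : Fin p → Fin p → ℝ) (z z' : Fin p → ℕ) : Prop :=
  ∀ j, z' j ∈ Finset.Icc 1 p ∧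
    ∀ a ∈ Finset.Icc 1 p, criterion y z j (z' j) ≤ criterion y z j a

end ApproxRanking

/-! Write `E_j` for the centred part of `∑_i (Y_ji - Y_ij)`, a normal variable of variance `2(p-1)`.
As `z*` is nearly a permutation, its labels sum to almost `p(p+1)/2`, so the feature of `j` is close
to `2pβ*(z*_j - (p+1)/2) + E_j`, and a step rounds it to the grid of mesh `2pβ̂`. If `β̂` has
relative error at most `ρ/p`, player `j` can move only when `|E_j| ≥ (1-3ρ)p|β*|`, and then by at
most a multiple of `|E_j|/(p|β*|)` (`IsStep.displacement_le`). The new loss is thus at most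
`truncatedNoise`, which does not involve the iterates (`IsStep.loss_le`). One application of
Markov's inequality to this variable serves all `t`; the Gaussian tail at `p|β*|` gives the exponent
`p(β*)²/4`. The term `ℓ(z^(t-1), z*)/2` is only nonnegative slack. The accuracy of `β̂` is
deterministic on the event `∑ E_j² ≤ 32p²`, for every label vector near `z*` (`betaHat_sub_sq_le`).
The iterates stay near `z*` by induction, since the bound on the new loss is at most `p`, well below
`p²(β*)²` (`guarantee_of_le`). The two bad events cost `exp(-√(p(β*)²))` and `2/p`. -/

namespace ApproxRanking

/-! ### Sums of squared pairwise differences -/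

/-- The sum of squared differences over all ordered pairs. -/
def pairSq {p : ℕ} (v : Fin p → ℝ) : ℝ := ∑ i, ∑ j, (v i - v j) ^ 2

lemma sum_sum_sub_mul_sub {p : ℕ} (v w : Fin p → ℝ) :
    ∑ i, ∑ j, (v i - v j) * (w i - w j) =
      2 * (p : ℝ) * ∑ i, v i * w i - 2 * (∑ i, v i) * ∑ i, w i := by
  have h : ∀ i j, (v i - v j) * (w i - w j) = v i * w i + v j * w j - v i * w j - w i * v j :=
    fun i j => by ring
  simp_rw [h, Finset.sum_sub_distrib, Finset.sum_add_distrib, Finset.sum_const,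
    ← Finset.mul_sum, ← Finset.sum_mul]
  simp only [Finset.card_univ, Fintype.card_fin, nsmul_eq_mul, ← Finset.mul_sum]
  ring

lemma pairSq_eq {p : ℕ} (v : Fin p → ℝ) :
    pairSq v = 2 * (p : ℝ) * ∑ i, v i ^ 2 - 2 * (∑ i, v i) ^ 2 := by
  have := sum_sum_sub_mul_sub v v
  simp only [← sq] at this
  rw [pairSq, this]; ring

lemma pairSq_le {p : ℕ} (v : Fin p → ℝ) : pairSq v ≤ 2 * (p : ℝ) * ∑ i, v i ^ 2 := by
  rw [pairSq_eq]; nlinarith [sq_nonneg (∑ i, v i)]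

lemma pairSq_add_le {p : ℕ} (v w : Fin p → ℝ) :
    pairSq (v + w) ≤ 2 * pairSq v + 2 * pairSq w := by
  simp only [pairSq, Finset.mul_sum, ← Finset.sum_add_distrib, Pi.add_apply]
  gcongr with i _ j _
  nlinarith [sq_nonneg ((v i - v j) - (w i - w j))]

lemma sq_sum_sum_sub_mul_sub_le {p : ℕ} (v w : Fin p → ℝ) :
    (∑ i, ∑ j, (v i - v j) * (w i - w j)) ^ 2 ≤ pairSq v * pairSq w := by
  simp only [pairSq, ← Finset.sum_product']
  exact Finset.sum_mul_sq_le_sq_mul_sq _ _ _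

lemma sum_range_add_one (p : ℕ) : ∑ i ∈ Finset.range p, ((i : ℝ) + 1) = p * (p + 1) / 2 := by
  induction p with
  | zero => simp
  | succ n ih => rw [Finset.sum_range_succ, ih]; push_cast; ring

lemma sum_range_add_one_sq (p : ℕ) :
    ∑ i ∈ Finset.range p, ((i : ℝ) + 1) ^ 2 = (p : ℝ) * (p + 1) * (2 * p + 1) / 6 := by
  induction p with
  | zero => simp
  | succ n ih => rw [Finset.sum_range_succ, ih]; push_cast; ring

lemma sum_perm {p : ℕ} (σ : Equiv.Perm (Fin p)) :
    ∑ j, (((σ j : ℕ) : ℝ) + 1) = p * (p + 1) / 2 := by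
  rw [Equiv.sum_comp σ (fun k : Fin p => ((k : ℕ) : ℝ) + 1),
    Fin.sum_univ_eq_sum_range (fun k => (k : ℝ) + 1), sum_range_add_one]

lemma sum_perm_sq {p : ℕ} (σ : Equiv.Perm (Fin p)) :
    ∑ j, (((σ j : ℕ) : ℝ) + 1) ^ 2 = (p : ℝ) * (p + 1) * (2 * p + 1) / 6 := by
  rw [Equiv.sum_comp σ (fun k : Fin p => (((k : ℕ) : ℝ) + 1) ^ 2),
    Fin.sum_univ_eq_sum_range (fun k => ((k : ℝ) + 1) ^ 2), sum_range_add_one_sq]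

lemma pairSq_perm {p : ℕ} (σ : Equiv.Perm (Fin p)) :
    pairSq (fun j => ((σ j : ℕ) : ℝ) + 1) = (p : ℝ) ^ 2 * ((p : ℝ) ^ 2 - 1) / 6 := by
  rw [pairSq_eq, sum_perm, sum_perm_sq]; ring

/-- Keeps the denominator of `β̂` of order `p⁴`: a permutation has `p²(p²-1)/6`, and the
perturbation contributes at most `p²/8`. The constant `1/32` is what remains at `p = 2`. -/
lemma pairSq_lower_bound {p : ℕ} (hp : 2 ≤ p) {σ : Equiv.Perm (Fin p)} {v : Fin p → ℝ}
    (hv : ∑ j, (v j - (((σ j : ℕ) : ℝ) + 1)) ^ 2 ≤ (p : ℝ) / 16) :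
    (p : ℝ) ^ 4 / 32 ≤ pairSq v := by
  have hp' : (2 : ℝ) ≤ p := by exact_mod_cast hp
  have h1 := pairSq_add_le v (fun j => (((σ j : ℕ) : ℝ) + 1) - v j)
  have h2 : v + (fun j => (((σ j : ℕ) : ℝ) + 1) - v j) = fun j => ((σ j : ℕ) : ℝ) + 1 := by
    ext j; simp
  rw [h2, pairSq_perm] at h1
  have h3 := pairSq_le (fun j => (((σ j : ℕ) : ℝ) + 1) - v j)
  have h4 : ∑ j, ((((σ j : ℕ) : ℝ) + 1) - v j) ^ 2 ≤ (p : ℝ) / 16 := by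
    simpa only [sub_sq_comm] using hv
  have h5 : 2 * (p : ℝ) * ∑ j, ((((σ j : ℕ) : ℝ) + 1) - v j) ^ 2 ≤ 2 * p * (p / 16) := by gcongr
  have h6 : (4 : ℝ) ≤ (p : ℝ) ^ 2 := by nlinarith
  nlinarith [mul_nonneg (sq_nonneg (p : ℝ)) (sub_nonneg.2 h6)]

/-! ### The least-squares estimator -/

/-- The noise `∑_i (w_{ji} - w_{ij})` in the feature of player `j`, where
`w_{ij} = y_{ij} - b (z*_i - z*_j)`. -/
def noise {p : ℕ} (y : Fin p → Fin p → ℝ) (b : ℝ) (zs : Fin p → ℕ) (j : Fin p) : ℝ :=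
  ∑ i, ((y j i - b * ((zs j : ℝ) - zs i)) - (y i j - b * ((zs i : ℝ) - zs j)))

variable {p : ℕ} {y : Fin p → Fin p → ℝ} {b : ℝ} {zs z z' : Fin p → ℕ}

lemma sum_erase_sub (j : Fin p) :
    ∑ i ∈ Finset.univ.erase j, (y j i - y i j) =
      noise y b zs j + 2 * b * (p * zs j - ∑ i, (zs i : ℝ)) := by
  rw [Finset.sum_erase _ (sub_self _), noise]
  have : ∀ i, ((y j i - b * ((zs j : ℝ) - zs i)) - (y i j - b * ((zs i : ℝ) - zs j))) =
      (y j i - y i j) - 2 * b * zs j + 2 * b * zs i := fun i => by ring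
  simp_rw [this, Finset.sum_add_distrib, Finset.sum_sub_distrib, ← Finset.mul_sum,
    Finset.sum_const, Finset.card_univ, Fintype.card_fin, nsmul_eq_mul]
  ring

lemma betaHat_eq (y : Fin p → Fin p → ℝ) (z : Fin p → ℕ) :
    betaHat y z = (∑ i, ∑ j, ((z i : ℝ) - z j) * y i j) / pairSq (fun i => (z i : ℝ)) := by
  rw [betaHat, pairSq]
  congr 1 <;> refine Finset.sum_congr rfl fun i _ => Finset.sum_erase _ (by simp)

/-- Splits the numerator of `β̂ - b` into noise and bias. Exchanging the indices collects the noise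
into the `p` variables `noise`, so their squared norm controls all `z` at once. -/
lemma sum_sum_sub_mul_eq (y : Fin p → Fin p → ℝ) (b : ℝ) (zs z : Fin p → ℕ) :
    ∑ i, ∑ j, ((z i : ℝ) - z j) * y i j - b * pairSq (fun i => (z i : ℝ)) =
      ∑ i, z i * noise y b zs i +
        b * ∑ i, ∑ j, ((z i : ℝ) - z j) * (((zs i : ℝ) - z i) - ((zs j : ℝ) - z j)) := by
  have h1 : ∑ i, (z i : ℝ) * noise y b zs i =
      ∑ i, ∑ j, ((z i : ℝ) - z j) * (y i j - b * ((zs i : ℝ) - zs j)) := by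
    have hc : ∑ i, ∑ j, (z j : ℝ) * (y i j - b * ((zs i : ℝ) - zs j)) =
      ∑ i, ∑ j, (z i : ℝ) * (y j i - b * ((zs j : ℝ) - zs i)) := Finset.sum_comm
    simp_rw [sub_mul _ _ (y _ _ - _), Finset.sum_sub_distrib (f := fun j => (z _ : ℝ) * (y _ j - _))]
    rw [Finset.sum_sub_distrib, hc, ← Finset.sum_sub_distrib]
    refine Finset.sum_congr rfl fun i _ => ?_
    rw [noise, Finset.mul_sum, ← Finset.sum_sub_distrib]
    exact Finset.sum_congr rfl fun j _ => by ring
  rw [h1, pairSq]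
  simp_rw [Finset.mul_sum, ← Finset.sum_sub_distrib, ← Finset.sum_add_distrib]
  exact Finset.sum_congr rfl fun i _ => Finset.sum_congr rfl fun j _ => by ring

/-- The estimator is accurate at any label vector which is close to the truth. -/
lemma betaHat_sub_sq_le (hp : 2 ≤ p) {σ : Equiv.Perm (Fin p)} {κ K : ℝ} (hκ : κ ≤ 1 / 64)
    (hσ : ∑ j, ((zs j : ℝ) - (((σ j : ℕ) : ℝ) + 1)) ^ 2 ≤ κ * p)
    (hz : IsLabel z) (hzz : ∑ j, ((z j : ℝ) - zs j) ^ 2 ≤ κ * p)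
    (hK : ∑ j, noise y b zs j ^ 2 ≤ K * p ^ 2) :
    (betaHat y z - b) ^ 2 ≤ 128 * κ * b ^ 2 / p ^ 2 + 2048 * K / p ^ 3 := by
  have hp' : (2 : ℝ) ≤ p := by exact_mod_cast hp
  have hp0 : (0 : ℝ) < p := by linarith
  have hS : (p : ℝ) ^ 4 / 32 ≤ pairSq (fun i => (z i : ℝ)) := by
    refine pairSq_lower_bound hp (σ := σ) ?_
    calc ∑ j, ((z j : ℝ) - (((σ j : ℕ) : ℝ) + 1)) ^ 2
        ≤ ∑ j, (2 * ((z j : ℝ) - zs j) ^ 2 + 2 * ((zs j : ℝ) - (((σ j : ℕ) : ℝ) + 1)) ^ 2) := by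
          gcongr with j _
          nlinarith [sq_nonneg (((z j : ℝ) - zs j) - ((zs j : ℝ) - (((σ j : ℕ) : ℝ) + 1)))]
      _ ≤ 2 * (κ * p) + 2 * (κ * p) := by
          rw [Finset.sum_add_distrib, ← Finset.mul_sum, ← Finset.mul_sum]; gcongr
      _ ≤ p / 16 := by nlinarith
  set S := pairSq (fun i => (z i : ℝ)) with hSdef
  have hS0 : 0 < S := lt_of_lt_of_le (by positivity) hS
  have hκ0 : 0 ≤ κ := by
    by_contra h
    have : κ * p < 0 := mul_neg_of_neg_of_pos (not_le.1 h) hp0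
    linarith [Finset.sum_nonneg fun j (_ : j ∈ Finset.univ) => sq_nonneg ((z j : ℝ) - zs j)]
  have hK0 : 0 ≤ K * p ^ 2 := hK.trans' (Finset.sum_nonneg fun j _ => sq_nonneg _)
  have hK0' : 0 ≤ K := nonneg_of_mul_nonneg_left hK0 (by positivity)
  set N₁ := ∑ i, (z i : ℝ) * noise y b zs i with hN₁
  set N₂ := ∑ i, ∑ j, ((z i : ℝ) - z j) * (((zs i : ℝ) - z i) - ((zs j : ℝ) - z j)) with hN₂
  have hd : betaHat y z - b = (N₁ + b * N₂) / S := by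
    rw [betaHat_eq, ← sum_sum_sub_mul_eq y b zs z, ← hSdef]; field_simp
  have h1 : N₁ ^ 2 ≤ p ^ 3 * (K * p ^ 2) := by
    refine (Finset.sum_mul_sq_le_sq_mul_sq _ _ _).trans ?_
    gcongr
    calc ∑ i, (z i : ℝ) ^ 2 ≤ ∑ _i : Fin p, (p : ℝ) ^ 2 := by
          gcongr with i _
          exact_mod_cast (Finset.mem_Icc.1 (hz i)).2
      _ = (p : ℝ) ^ 3 := by simp; ring
  -- One factor `S` is kept here to cancel against the `S ^ 2` below.
  have h2 : N₂ ^ 2 ≤ S * (2 * p * (κ * p)) := by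
    refine (sq_sum_sum_sub_mul_sub_le (fun i => (z i : ℝ)) (fun i => (zs i : ℝ) - z i)).trans ?_
    gcongr
    refine (pairSq_le _).trans ?_
    gcongr
    simpa only [sub_sq_comm] using hzz
  have h3 : (N₁ + b * N₂) ^ 2 ≤ 2 * (p ^ 3 * (K * p ^ 2)) + 2 * b ^ 2 * (S * (2 * p * (κ * p))) := by
    nlinarith [sq_nonneg (N₁ - b * N₂), mul_le_mul_of_nonneg_left h2 (sq_nonneg b)]
  rw [hd, div_pow]
  calc (N₁ + b * N₂) ^ 2 / S ^ 2
      ≤ (2 * (p ^ 3 * (K * p ^ 2)) + 2 * b ^ 2 * (S * (2 * p * (κ * p)))) / S ^ 2 := by gcongr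
    _ = 2 * (p ^ 3 * (K * p ^ 2)) / S ^ 2 + 2 * b ^ 2 * (2 * p * (κ * p)) / S := by
        field_simp
    _ ≤ 2 * (p ^ 3 * (K * p ^ 2)) / ((p : ℝ) ^ 4 / 32) ^ 2 +
          2 * b ^ 2 * (2 * p * (κ * p)) / ((p : ℝ) ^ 4 / 32) := by
        gcongr
    _ = 128 * κ * b ^ 2 / p ^ 2 + 2048 * K / p ^ 3 := by
        field_simp; ring

/-! ### One iteration -/

/-- If the estimator has relative error at most `ρ / p`, then a moved label is only possible for
players with large noise, and the displacement is controlled by the noise. -/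
lemma IsStep.displacement_le (hp : 2 ≤ p) {σ : Equiv.Perm (Fin p)} {ρ : ℝ}
    (hρ0 : 0 ≤ ρ) (hρ : ρ ≤ 1 / 6)
    (hb : b ≠ 0) (hσ : ∑ j, ((zs j : ℝ) - (((σ j : ℕ) : ℝ) + 1)) ^ 2 ≤ ρ ^ 2 / 4 * p)
    (hzs : IsLabel zs) (hβ : |betaHat y z - b| ≤ ρ * |b| / p) (hstep : IsStep y z z')
    {j : Fin p} (hj : z' j ≠ zs j) :
    (1 - 3 * ρ) * (p * |b|) * |(z' j : ℝ) - zs j| ≤ |noise y b zs j| := by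
  have hp' : (2 : ℝ) ≤ p := by exact_mod_cast hp
  have hp0 : (0 : ℝ) < p := by linarith
  have hb0 : 0 < |b| := abs_pos.2 hb
  have hmin := (hstep j).2 (zs j) (hzs j)
  set B := betaHat y z with hB
  set E := noise y b zs j with hE
  have hBlow : (1 - ρ) * |b| ≤ |B| := by
    have h1 : |b| ≤ |B| + |B - b| := by
      have := abs_sub_abs_le_abs_sub b B
      rw [abs_sub_comm] at this; linarith
    have h2 : ρ * |b| / p ≤ ρ * |b| := div_le_self (by positivity) (by linarith)
    nlinarith
  set r := ∑ i ∈ Finset.univ.erase j, (y j i - y i j)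
    - 2 * (p : ℝ) * B * ((zs j : ℝ) - ((p : ℝ) + 1) / 2) with hr
  set d := (z' j : ℝ) - zs j with hd
  have hd1 : 1 ≤ |d| := by
    have h1 : (z' j : ℤ) - zs j ≠ 0 := sub_ne_zero.2 (by exact_mod_cast hj)
    have h2 : (1 : ℤ) ≤ |(z' j : ℤ) - zs j| := Int.one_le_abs h1
    have h3 : ((1 : ℤ) : ℝ) ≤ ((|(z' j : ℤ) - zs j| : ℤ) : ℝ) := by exact_mod_cast h2
    simpa [hd] using h3
  -- The competitor is the true label, whose residual is `r`. Expanding the square shows that `|r|`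
  -- is at least half the shift `2p|B||d|`.
  have hkey : (r - 2 * p * B * d) ^ 2 ≤ r ^ 2 := by
    simp only [criterion, sq_abs] at hmin
    refine le_trans (le_of_eq ?_) hmin
    rw [hr, hd]; ring
  have hdr : p * |B| * |d| ≤ |r| := by
    have h1 : (p * |B| * |d|) * (p * |B| * |d|) ≤ (p * |B| * |d|) * |r| := by
      have h2 : B * d * r ≤ |B| * |d| * |r| := by rw [← abs_mul, ← abs_mul]; exact le_abs_self _
      have h3 : (p * |B| * |d|) * (p * |B| * |d|) = p ^ 2 * (B ^ 2 * d ^ 2) := by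
        rw [← sq_abs B, ← sq_abs d]; ring
      rw [h3]
      nlinarith
    have hpos : 0 < p * |B| * |d| := by
      have : 0 < |B| := lt_of_lt_of_le (mul_pos (by linarith) hb0) hBlow
      have : 0 < |d| := by linarith
      positivity
    exact le_of_mul_le_mul_left h1 hpos
  -- The defect of `∑ zs` from `p(p+1)/2` and the error of `B` contribute `ρp|b|` each. The latter
  -- is multiplied by `2p` and by a centred label of size up to `p/2`, hence the accuracy `ρ/p`.
  have hrE : |r - E| ≤ 2 * ρ * (p * |b|) := by
    have h1 : r - E = 2 * b * ((p : ℝ) * (p + 1) / 2 - ∑ i, (zs i : ℝ))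
        + 2 * p * ((b - B) * ((zs j : ℝ) - ((p : ℝ) + 1) / 2)) := by
      rw [hr, sum_erase_sub (b := b) (zs := zs) j, hE]; ring
    have h2 : |(p : ℝ) * (p + 1) / 2 - ∑ i, (zs i : ℝ)| ≤ ρ / 2 * p := by
      refine abs_le_of_sq_le_sq ?_ (by positivity)
      have h3 : (∑ i, ((zs i : ℝ) - (((σ i : ℕ) : ℝ) + 1))) ^ 2 ≤
          p * ∑ i, ((zs i : ℝ) - (((σ i : ℕ) : ℝ) + 1)) ^ 2 := by
        simpa using sq_sum_le_card_mul_sum_sq (s := (Finset.univ : Finset (Fin p)))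
          (f := fun i => (zs i : ℝ) - (((σ i : ℕ) : ℝ) + 1))
      rw [Finset.sum_sub_distrib, sum_perm, sub_sq_comm] at h3
      refine h3.trans ?_
      calc _ ≤ (p : ℝ) * (ρ ^ 2 / 4 * p) := by gcongr
        _ = _ := by ring
    have h3 : |(zs j : ℝ) - ((p : ℝ) + 1) / 2| ≤ p / 2 := by
      have h4 := Finset.mem_Icc.1 (hzs j)
      have h5 : (1 : ℝ) ≤ zs j := by exact_mod_cast h4.1
      have h6 : (zs j : ℝ) ≤ p := by exact_mod_cast h4.2
      rw [abs_le]; constructor <;> linarith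
    rw [h1]
    refine (abs_add_le _ _).trans ?_
    rw [abs_mul, abs_mul, abs_mul (2 * (p : ℝ)), abs_mul (b - B), abs_sub_comm b B,
      abs_of_pos (by positivity : (0 : ℝ) < 2 * p), abs_two]
    calc _ ≤ 2 * |b| * (ρ / 2 * p) + 2 * p * (ρ * |b| / p * (p / 2)) := by gcongr
      _ = _ := by field_simp; ring
  have hr' : |r| ≤ |E| + |r - E| := by
    have := abs_sub_abs_le_abs_sub r E; linarith
  have h7 : (1 - ρ) * (p * |b|) * |d| ≤ p * |B| * |d| := by
    calc (1 - ρ) * (p * |b|) * |d| = p * ((1 - ρ) * |b|) * |d| := by ring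
      _ ≤ _ := by gcongr
  -- Distinct labels differ by at least `1`, so the additive error is absorbed into the factor of
  -- `|d|`: `1 - ρ - 2ρ = 1 - 3ρ`.
  have h8 : 2 * ρ * (p * |b|) ≤ 2 * ρ * (p * |b|) * |d| :=
    le_mul_of_one_le_right (by positivity) hd1
  nlinarith

/-- The truncated noise energy, a bound on the loss after one iteration. -/
noncomputable def truncatedNoise (y : Fin p → Fin p → ℝ) (b : ℝ) (zs : Fin p → ℕ) (u : ℝ) : ℝ :=
  8 / ((p : ℝ) - 1) * ∑ j, if u ≤ |noise y b zs j| then noise y b zs j ^ 2 else 0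

lemma IsStep.loss_le (hp : 2 ≤ p) {σ : Equiv.Perm (Fin p)} {ρ : ℝ}
    (hρ0 : 0 ≤ ρ) (hρ : ρ ≤ 1 / 12)
    (hb : b ≠ 0) (hσ : ∑ j, ((zs j : ℝ) - (((σ j : ℕ) : ℝ) + 1)) ^ 2 ≤ ρ ^ 2 / 4 * p)
    (hzs : IsLabel zs) (hβ : |betaHat y z - b| ≤ ρ * |b| / p) (hstep : IsStep y z z') :
    loss b z' zs ≤ truncatedNoise y b zs ((1 - 3 * ρ) * (p * |b|)) := by
  have hp' : (2 : ℝ) ≤ p := by exact_mod_cast hp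
  have hp0 : (0 : ℝ) < p := by linarith
  have hp1 : (0 : ℝ) < p - 1 := by linarith
  have hb0 : 0 < |b| := abs_pos.2 hb
  have hterm : ∀ j, (p * |b|) ^ 2 * ((z' j : ℝ) - zs j) ^ 2 ≤
      4 * if (1 - 3 * ρ) * (p * |b|) ≤ |noise y b zs j| then noise y b zs j ^ 2 else 0 := by
    intro j
    by_cases hj : z' j = zs j
    · rw [hj, sub_self]
      split_ifs <;> nlinarith [sq_nonneg (noise y b zs j)]
    have h := hstep.displacement_le hp hρ0 (by linarith) hb hσ hzs hβ hj
    have hd1 : 1 ≤ |(z' j : ℝ) - zs j| := by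
      have h1 : (z' j : ℤ) - zs j ≠ 0 := sub_ne_zero.2 (by exact_mod_cast hj)
      have h2 : (1 : ℤ) ≤ |(z' j : ℤ) - zs j| := Int.one_le_abs h1
      have h3 : ((1 : ℤ) : ℝ) ≤ ((|(z' j : ℤ) - zs j| : ℤ) : ℝ) := by exact_mod_cast h2
      simpa using h3
    have hq : 0 ≤ (1 - 3 * ρ) * (p * |b|) := mul_nonneg (by linarith) (by positivity)
    rw [if_pos ((le_mul_of_one_le_right hq hd1).trans h)]
    have h2 : (p * |b|) * |(z' j : ℝ) - zs j| ≤ 2 * |noise y b zs j| := by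
      have : 0 ≤ (p * |b|) * |(z' j : ℝ) - zs j| := by positivity
      nlinarith
    rw [← sq_abs ((z' j : ℝ) - zs j), ← sq_abs (noise y b zs j), ← mul_pow]
    calc _ ≤ (2 * |noise y b zs j|) ^ 2 := by gcongr
      _ = _ := by ring
  have hsum := Finset.sum_le_sum fun j (_ : j ∈ Finset.univ) => hterm j
  rw [← Finset.mul_sum, ← Finset.mul_sum, mul_pow, sq_abs] at hsum
  rw [loss, truncatedNoise]
  calc _ = 2 / ((p : ℝ) - 1) * (p ^ 2 * b ^ 2 * ∑ j, ((z' j : ℝ) - zs j) ^ 2) := by ring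
    _ ≤ 2 / ((p : ℝ) - 1) * (4 * ∑ j, if (1 - 3 * ρ) * (p * |b|) ≤ |noise y b zs j| then
          noise y b zs j ^ 2 else 0) := by gcongr
    _ = _ := by ring

/-! ### Gaussian estimates -/

section Gaussian

variable {Ω : Type*} [MeasurableSpace Ω] {P : Measure Ω}

/-- The tilt leaves the fraction `θ` of the Gaussian exponent, i.e. an unnormalised density of
variance `v/θ`. -/
lemma integral_exp_mul_sq_gaussianReal {v : NNReal} (hv : v ≠ 0) {θ : ℝ} (hθ : 0 < θ) :
    ∫ x, Real.exp ((1 - θ) / (2 * v) * x ^ 2) ∂(gaussianReal 0 v) = (√θ)⁻¹ := by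
  have hv0 : (0 : ℝ) < v := by positivity
  rw [integral_gaussianReal_eq_integral_smul hv]
  have h : ∀ x : ℝ, gaussianPDFReal 0 v x • Real.exp ((1 - θ) / (2 * v) * x ^ 2) =
      (√(2 * Real.pi * v))⁻¹ * Real.exp (-(θ / (2 * v)) * x ^ 2) := fun x => by
    rw [gaussianPDFReal, smul_eq_mul, mul_assoc, ← Real.exp_add]
    congr 2
    field_simp
    ring
  simp_rw [h]
  rw [integral_const_mul, integral_gaussian, ← Real.sqrt_inv, ← Real.sqrt_inv, ← Real.sqrt_mul
    (by positivity)]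
  congr 1
  field_simp

lemma integrable_exp_mul_sq_gaussianReal {v : NNReal} (hv : v ≠ 0) {θ : ℝ} (hθ : 0 < θ) :
    Integrable (fun x => Real.exp ((1 - θ) / (2 * v) * x ^ 2)) (gaussianReal 0 v) := by
  -- The integral of a non-integrable function is `0` by convention, whereas the value just computed
  -- is positive.
  by_contra h
  have h1 := integral_exp_mul_sq_gaussianReal hv hθ
  rw [integral_undef h] at h1
  have : 0 < (√θ)⁻¹ := by positivity
  linarith

/-- The exponent `1 - θ` is split as `θ + (1 - 2θ)`: the first part dominates `x²` through `s ≤ exp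
s`, the second pays for the truncation at `u`. -/
lemma truncated_sq_le {v u θ : ℝ} (hv : 0 < v) (hu : 0 ≤ u) (hθ : 0 < θ) (hθ' : θ ≤ 1 / 2) (x : ℝ) :
    (if u ≤ |x| then x ^ 2 else 0) ≤
      2 * v / θ * Real.exp (-(1 - 2 * θ) * u ^ 2 / (2 * v)) *
        Real.exp ((1 - θ) / (2 * v) * x ^ 2) := by
  split_ifs with h
  · have hx : u ^ 2 ≤ x ^ 2 := by rw [← sq_abs x]; gcongr
    have h1 : θ / (2 * v) * x ^ 2 ≤ Real.exp (θ / (2 * v) * x ^ 2) :=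
      (by linarith : θ / (2 * v) * x ^ 2 ≤ θ / (2 * v) * x ^ 2 + 1).trans (Real.add_one_le_exp _)
    have h2 : 1 ≤ Real.exp ((1 - 2 * θ) / (2 * v) * (x ^ 2 - u ^ 2)) :=
      Real.one_le_exp (mul_nonneg (div_nonneg (by linarith) (by positivity)) (by linarith))
    have h3 : Real.exp (-(1 - 2 * θ) * u ^ 2 / (2 * v)) * Real.exp ((1 - θ) / (2 * v) * x ^ 2) =
        Real.exp (θ / (2 * v) * x ^ 2) * Real.exp ((1 - 2 * θ) / (2 * v) * (x ^ 2 - u ^ 2)) := by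
      rw [← Real.exp_add, ← Real.exp_add]; congr 1; field_simp; ring
    rw [mul_assoc, h3]
    calc x ^ 2 = 2 * v / θ * (θ / (2 * v) * x ^ 2 * 1) := by field_simp
      _ ≤ _ := by gcongr
  · positivity

lemma integrable_truncated_sq {X : Ω → ℝ} {v : NNReal}
    (hX : HasLaw X (gaussianReal 0 v) P) {u : ℝ} :
    Integrable (fun ω => if u ≤ |X ω| then X ω ^ 2 else 0) P := by
  have : Integrable (fun x : ℝ => x ^ 2) (gaussianReal 0 v) :=
    (memLp_id_gaussianReal 2).integrable_sq
  have h2 : Integrable (fun x : ℝ => if u ≤ |x| then x ^ 2 else 0) (gaussianReal 0 v) := by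
    refine this.mono' (Measurable.aestronglyMeasurable ?_) (ae_of_all _ fun x => ?_)
    · exact Measurable.ite (measurableSet_le measurable_const (by fun_prop)) (by fun_prop)
        measurable_const
    · split_ifs <;> simp [sq_nonneg]
  rw [← hX.map_eq] at h2
  exact h2.comp_aemeasurable hX.aemeasurable

lemma integral_truncated_sq_le {X : Ω → ℝ} {v : NNReal} (hv : v ≠ 0)
    (hX : HasLaw X (gaussianReal 0 v) P) {u θ : ℝ} (hu : 0 ≤ u) (hθ : 0 < θ) (hθ' : θ ≤ 1 / 2) :
    ∫ ω, (if u ≤ |X ω| then X ω ^ 2 else 0) ∂P ≤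
      2 * v / θ * Real.exp (-(1 - 2 * θ) * u ^ 2 / (2 * v)) * (√θ)⁻¹ := by
  have hv0 : (0 : ℝ) < v := by positivity
  have hint := integrable_exp_mul_sq_gaussianReal hv hθ
  have h1 : ∫ ω, Real.exp ((1 - θ) / (2 * v) * X ω ^ 2) ∂P = (√θ)⁻¹ := by
    rw [← integral_exp_mul_sq_gaussianReal hv hθ]
    exact hX.integral_comp (f := fun x => Real.exp ((1 - θ) / (2 * v) * x ^ 2))
      hint.aestronglyMeasurable
  rw [← h1, ← integral_const_mul]
  refine integral_mono (integrable_truncated_sq hX) (Integrable.const_mul ?_ _)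
    fun ω => truncated_sq_le hv0 hu hθ hθ' _
  rw [← hX.map_eq] at hint
  exact hint.comp_aemeasurable hX.aemeasurable

/-- A chi-square tail bound. -/
lemma measureReal_sum_sq_ge_le {n : ℕ} (hn : n ≠ 0) {X : Fin n → Ω → ℝ} {v : NNReal} (hv : v ≠ 0)
    [IsProbabilityMeasure P] (hX : ∀ j, HasLaw (X j) (gaussianReal 0 v) P)
    (hind : iIndepFun X P) :
    P.real {ω | 8 * n * (v : ℝ) ≤ ∑ j, X j ω ^ 2} ≤ (n : ℝ)⁻¹ := by
  have hv0 : (0 : ℝ) < v := by positivity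
  -- The tilt with `θ = 1/2`: each factor of the generating function is `√2 ≤ 2`, and `t * (8nv) =
  -- 2n`, so Chernoff gives at most `(2e⁻²)^n ≤ 2⁻ⁿ ≤ 1/n`.
  set t : ℝ := (1 - 1 / 2) / (2 * v) with ht
  have ht0 : 0 ≤ t := by rw [ht]; positivity
  have hexp : Measurable fun x : ℝ => x ^ 2 := by fun_prop
  have hind2 : iIndepFun (fun j ω => X j ω ^ 2) P := hind.comp (fun _ x => x ^ 2) fun _ => hexp
  have hmeas : ∀ j, AEMeasurable (fun ω => X j ω ^ 2) P := fun j =>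
    hexp.comp_aemeasurable (hX j).aemeasurable
  have hmgf1 : ∀ j, mgf (fun ω => X j ω ^ 2) P t = (√(1 / 2))⁻¹ := fun j => by
    rw [← integral_exp_mul_sq_gaussianReal hv (by norm_num : (0 : ℝ) < 1 / 2)]
    exact (hX j).integral_comp (f := fun x => Real.exp (t * x ^ 2)) (by fun_prop)
  have hmgf : mgf (∑ j, fun ω => X j ω ^ 2) P t = ((√(1 / 2))⁻¹) ^ n := by
    rw [hind2.mgf_sum₀ hmeas, Finset.prod_congr rfl fun j _ => hmgf1 j]; simp
  have hsqrt : (√(1 / 2 : ℝ))⁻¹ ≤ 2 := by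
    rw [inv_le_comm₀ (by positivity) (by norm_num)]
    exact Real.le_sqrt_of_sq_le (by norm_num)
  have hint : Integrable (fun ω => Real.exp (t * (∑ j, fun ω => X j ω ^ 2) ω)) P := by
    by_contra h
    have : mgf (∑ j, fun ω => X j ω ^ 2) P t = 0 := integral_undef h
    rw [hmgf] at this
    exact absurd this (by positivity)
  have h := measure_ge_le_exp_mul_mgf (8 * n * (v : ℝ)) ht0 hint
  rw [hmgf] at h
  have he : Real.exp (-t * (8 * n * v)) = Real.exp (-2) ^ n := by
    rw [← Real.exp_nat_mul]; congr 1; rw [ht]; field_simp; ring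
  have he2 : Real.exp (-2) ≤ 1 / 4 := by
    have h1 : (2 : ℝ) ≤ Real.exp 1 := by linarith [Real.add_one_le_exp (1 : ℝ)]
    have h2 : Real.exp 2 = Real.exp 1 * Real.exp 1 := by rw [← Real.exp_add]; norm_num
    rw [Real.exp_neg, inv_le_comm₀ (Real.exp_pos _) (by norm_num), h2]
    nlinarith
  simp only [Finset.sum_apply] at h
  refine h.trans ?_
  rw [he, ← mul_pow]
  calc (Real.exp (-2) * (√(1 / 2))⁻¹) ^ n ≤ (1 / 4 * 2) ^ n := by gcongr
    _ = ((2 : ℝ) ^ n)⁻¹ := by rw [← inv_pow]; norm_num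
    _ ≤ (n : ℝ)⁻¹ := by
      gcongr
      exact_mod_cast Nat.lt_two_pow_self.le

/-! ### Linear combinations of independent standard Gaussians -/

section LinearCombination

variable {ι κ : Type*} [Fintype ι] [Fintype κ] {Z : ι → Ω → ℝ}

lemma hasGaussianLaw_linearCombination (hZ : ∀ i, HasLaw (Z i) (gaussianReal 0 1) P)
    (hind : iIndepFun Z P) (a : κ → ι → ℝ) :
    HasGaussianLaw (fun ω k => ∑ i, a k i * Z i ω) P := by
  have h := (hind.hasGaussianLaw fun i => (hZ i).hasGaussianLaw).map_fun
    (Matrix.mulVecLin (Matrix.of a)).toContinuousLinearMap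
  exact h

variable [IsProbabilityMeasure P]

lemma covariance_linearCombination (hZ : ∀ i, HasLaw (Z i) (gaussianReal 0 1) P)
    (hind : iIndepFun Z P) (a b : ι → ℝ) :
    cov[fun ω => ∑ i, a i * Z i ω, fun ω => ∑ i, b i * Z i ω; P] = ∑ i, a i * b i := by
  classical
  have hL : ∀ i, MemLp (Z i) 2 P := fun i => (hZ i).hasGaussianLaw.memLp_two
  rw [covariance_fun_sum_fun_sum (fun i => (hL i).const_mul _) (fun i => (hL i).const_mul _)]
  refine Finset.sum_congr rfl fun i _ => ?_
  rw [Finset.sum_eq_single i]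
  · rw [covariance_const_mul_left, covariance_const_mul_right,
      covariance_self (hZ i).aemeasurable, (hZ i).variance_eq, variance_id_gaussianReal]
    simp
  · intro j _ hj
    rw [covariance_const_mul_left, covariance_const_mul_right,
      (hind.indepFun hj.symm).covariance_eq_zero (hL i) (hL j)]
    simp
  · simp

lemma hasLaw_linearCombination (hZ : ∀ i, HasLaw (Z i) (gaussianReal 0 1) P)
    (hind : iIndepFun Z P) (a : ι → ℝ) :
    HasLaw (fun ω => ∑ i, a i * Z i ω) (gaussianReal 0 (∑ i, a i ^ 2).toNNReal) P := by
  have h := (hasGaussianLaw_linearCombination hZ hind (fun _ : Unit => a)).eval ()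
  refine ⟨h.aemeasurable, ?_⟩
  rw [h.map_eq_gaussianReal]
  congr 1
  · rw [integral_finsetSum _ fun i _ => ((hZ i).hasGaussianLaw.integrable.const_mul _)]
    refine Finset.sum_eq_zero fun i _ => ?_
    rw [integral_const_mul, (hZ i).integral_eq, integral_id_gaussianReal, mul_zero]
  · rw [← covariance_self h.aemeasurable, covariance_linearCombination hZ hind]
    simp [sq]

/-- The combinations are jointly Gaussian, so orthogonal coefficient vectors give independence. -/
lemma iIndepFun_linearCombination (hZ : ∀ i, HasLaw (Z i) (gaussianReal 0 1) P)
    (hind : iIndepFun Z P) (a : κ → ι → ℝ) (ha : ∀ k l, k ≠ l → ∑ i, a k i * a l i = 0) :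
    iIndepFun (fun k ω => ∑ i, a k i * Z i ω) P :=
  (hasGaussianLaw_linearCombination hZ hind a).iIndepFun_of_covariance_eq_zero fun k l hkl => by
    rw [covariance_linearCombination hZ hind, ha k l hkl]

end LinearCombination

end Gaussian

/-! ### The noise in the comparison model -/

/-- Ordered pairs of distinct players. -/
abbrev OffDiag (p : ℕ) := {ij : Fin p × Fin p // ij.1 ≠ ij.2}

lemma sum_offDiag {p : ℕ} (f : Fin p → Fin p → ℝ) :
    ∑ x : OffDiag p, f x.1.1 x.1.2 = ∑ i, ∑ j, if i ≠ j then f i j else 0 := by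
  rw [← Fintype.sum_prod_type' (f := fun i j => if i ≠ j then f i j else 0), ← Finset.sum_filter]
  exact (Finset.sum_subtype _ (by simp) (fun ij : Fin p × Fin p => f ij.1 ij.2)).symm

lemma sum_offDiag_fst {p : ℕ} (f : Fin p → Fin p → ℝ) (j : Fin p) :
    ∑ x : OffDiag p, (if x.1.1 = j then 1 else 0) * f x.1.1 x.1.2 =
      ∑ i, if j ≠ i then f j i else 0 := by
  rw [sum_offDiag (fun k i => (if k = j then 1 else 0) * f k i), Finset.sum_eq_single j]
  · simp
  · intro i _ hi; simp [hi]
  · simp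

lemma sum_offDiag_snd {p : ℕ} (f : Fin p → Fin p → ℝ) (j : Fin p) :
    ∑ x : OffDiag p, (if x.1.2 = j then 1 else 0) * f x.1.1 x.1.2 =
      ∑ i, if i ≠ j then f i j else 0 := by
  rw [sum_offDiag (fun k i => (if i = j then 1 else 0) * f k i)]
  refine Finset.sum_congr rfl fun i _ => ?_
  rw [Finset.sum_eq_single j]
  · simp
  · intro i _ hi; simp [hi]
  · simp

lemma sum_ite_ne_one {p : ℕ} (hp : 2 ≤ p) (j : Fin p) :
    ∑ i : Fin p, (if i ≠ j then (1 : ℝ) else 0) = p - 1 := by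
  rw [← Finset.sum_filter, Finset.filter_ne']
  simp [Nat.cast_sub (by lia : 1 ≤ p)]

section Model

variable {Ω : Type*} {p : ℕ} {b : ℝ} {zs : Fin p → ℕ} {Y : Fin p → Fin p → Ω → ℝ}

/-- The centred observations. -/
def centered (b : ℝ) (zs : Fin p → ℕ) (Y : Fin p → Fin p → Ω → ℝ) (x : OffDiag p) (ω : Ω) : ℝ :=
  Y x.1.1 x.1.2 ω - b * ((zs x.1.1 : ℝ) - zs x.1.2)

/-- The total noise in the comparisons with `j` as the first player. -/
def rowNoise (b : ℝ) (zs : Fin p → ℕ) (Y : Fin p → Fin p → Ω → ℝ) (j : Fin p) (ω : Ω) : ℝ :=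
  ∑ x : OffDiag p, (if x.1.1 = j then 1 else 0) * centered b zs Y x ω

/-- The total noise in the comparisons with `j` as the second player. -/
def colNoise (b : ℝ) (zs : Fin p → ℕ) (Y : Fin p → Fin p → Ω → ℝ) (j : Fin p) (ω : Ω) : ℝ :=
  ∑ x : OffDiag p, (if x.1.2 = j then 1 else 0) * centered b zs Y x ω

/-- The noises of two players share observations and are correlated. Row sums use disjoint sets of
observations, as do column sums, so the chi-square bound applies to each family separately. -/
lemma noise_eq (b : ℝ) (zs : Fin p → ℕ) (Y : Fin p → Fin p → Ω → ℝ) (j : Fin p) (ω : Ω) :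
    noise (fun i j => Y i j ω) b zs j = rowNoise b zs Y j ω - colNoise b zs Y j ω := by
  simp only [rowNoise, colNoise, centered]
  rw [sum_offDiag_fst (fun i k => Y i k ω - b * ((zs i : ℝ) - zs k)),
    sum_offDiag_snd (fun i k => Y i k ω - b * ((zs i : ℝ) - zs k)), noise,
    ← Finset.sum_sub_distrib]
  refine Finset.sum_congr rfl fun i _ => ?_
  by_cases hij : i = j
  · simp [hij]
  · simp [hij, Ne.symm hij]

lemma noise_eq_sum (b : ℝ) (zs : Fin p → ℕ) (Y : Fin p → Fin p → Ω → ℝ) (j : Fin p) (ω : Ω) :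
    noise (fun i j => Y i j ω) b zs j = ∑ x : OffDiag p,
      ((if x.1.1 = j then 1 else 0) - (if x.1.2 = j then 1 else 0)) * centered b zs Y x ω := by
  rw [noise_eq, rowNoise, colNoise, ← Finset.sum_sub_distrib]
  simp only [sub_mul]

lemma sum_fst_sq (hp : 2 ≤ p) (j : Fin p) :
    ∑ x : OffDiag p, (if x.1.1 = j then (1 : ℝ) else 0) ^ 2 = p - 1 := by
  have h := sum_offDiag_fst (p := p) (fun _ _ => 1) j
  simp only [ne_comm (a := j), sum_ite_ne_one hp] at h
  rw [← h]
  exact Finset.sum_congr rfl fun x _ => by split_ifs <;> simp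

lemma sum_snd_sq (hp : 2 ≤ p) (j : Fin p) :
    ∑ x : OffDiag p, (if x.1.2 = j then (1 : ℝ) else 0) ^ 2 = p - 1 := by
  have h := sum_offDiag_snd (p := p) (fun _ _ => 1) j
  rw [sum_ite_ne_one hp] at h
  rw [← h]
  exact Finset.sum_congr rfl fun x _ => by split_ifs <;> simp

variable [MeasurableSpace Ω] {P : Measure Ω}

lemma IsPairwiseComparison.hasLaw_centered (h : IsPairwiseComparison P b zs Y) (x : OffDiag p) :
    HasLaw (centered b zs Y x) (gaussianReal 0 1) P := by
  have := gaussianReal_sub_const (h.hasLaw x.1.1 x.1.2 x.2) (b * ((zs x.1.1 : ℝ) - zs x.1.2))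
  rwa [sub_self] at this

lemma IsPairwiseComparison.iIndepFun_centered (h : IsPairwiseComparison P b zs Y) :
    iIndepFun (centered b zs Y) P :=
  h.indep.comp (fun x y => y - b * ((zs x.1.1 : ℝ) - zs x.1.2)) fun _ => by fun_prop

variable [IsProbabilityMeasure P]

lemma IsPairwiseComparison.hasLaw_rowNoise (hp : 2 ≤ p) (h : IsPairwiseComparison P b zs Y)
    (j : Fin p) : HasLaw (rowNoise b zs Y j) (gaussianReal 0 ((p : ℝ) - 1).toNNReal) P := by
  rw [← sum_fst_sq hp j]
  exact hasLaw_linearCombination h.hasLaw_centered h.iIndepFun_centered _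

lemma IsPairwiseComparison.hasLaw_colNoise (hp : 2 ≤ p) (h : IsPairwiseComparison P b zs Y)
    (j : Fin p) : HasLaw (colNoise b zs Y j) (gaussianReal 0 ((p : ℝ) - 1).toNNReal) P := by
  rw [← sum_snd_sq hp j]
  exact hasLaw_linearCombination h.hasLaw_centered h.iIndepFun_centered _

lemma IsPairwiseComparison.iIndepFun_rowNoise (h : IsPairwiseComparison P b zs Y) :
    iIndepFun (rowNoise b zs Y) P := by
  refine iIndepFun_linearCombination h.hasLaw_centered h.iIndepFun_centered
    (fun j x => if x.1.1 = j then 1 else 0) fun k l hkl => Finset.sum_eq_zero fun x _ => ?_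
  by_cases hx : x.1.1 = k
  · simp [hx, hkl]
  · simp [hx]

lemma IsPairwiseComparison.iIndepFun_colNoise (h : IsPairwiseComparison P b zs Y) :
    iIndepFun (colNoise b zs Y) P := by
  refine iIndepFun_linearCombination h.hasLaw_centered h.iIndepFun_centered
    (fun j x => if x.1.2 = j then 1 else 0) fun k l hkl => Finset.sum_eq_zero fun x _ => ?_
  by_cases hx : x.1.2 = k
  · simp [hx, hkl]
  · simp [hx]

lemma IsPairwiseComparison.hasLaw_noise (hp : 2 ≤ p) (h : IsPairwiseComparison P b zs Y)
    (j : Fin p) : HasLaw (fun ω => noise (fun i j => Y i j ω) b zs j)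
      (gaussianReal 0 (2 * ((p : ℝ) - 1)).toNNReal) P := by
  have hs : ∑ x : OffDiag p, ((if x.1.1 = j then (1 : ℝ) else 0) -
      (if x.1.2 = j then 1 else 0)) ^ 2 = 2 * ((p : ℝ) - 1) := by
    rw [two_mul]
    nth_rw 1 [← sum_fst_sq hp j]
    rw [← sum_snd_sq hp j, ← Finset.sum_add_distrib]
    refine Finset.sum_congr rfl fun x _ => ?_
    by_cases h1 : x.1.1 = j
    · have h2 : x.1.2 ≠ j := fun h2 => x.2 (h1.trans h2.symm)
      simp [h1, h2]
    · simp [h1]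
  simp_rw [noise_eq_sum]
  rw [← hs]
  exact hasLaw_linearCombination h.hasLaw_centered h.iIndepFun_centered _

/-- With probability at least `1 - 2 / p`, the noise vector has squared norm at most `32 p²`. -/
lemma IsPairwiseComparison.measureReal_noise_le (hp : 2 ≤ p) (h : IsPairwiseComparison P b zs Y) :
    P.real {ω | ¬ ∑ j, noise (fun i j => Y i j ω) b zs j ^ 2 ≤ 32 * (p : ℝ) ^ 2} ≤
      2 * (p : ℝ)⁻¹ := by
  have hp' : (2 : ℝ) ≤ p := by exact_mod_cast hp
  have hp0 : p ≠ 0 := by lia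
  have hv : ((p : ℝ) - 1).toNNReal ≠ 0 := by
    rw [Ne, Real.toNNReal_eq_zero]; linarith
  have h1 := measureReal_sum_sq_ge_le hp0 hv (h.hasLaw_rowNoise hp) h.iIndepFun_rowNoise
  have h2 := measureReal_sum_sq_ge_le hp0 hv (h.hasLaw_colNoise hp) h.iIndepFun_colNoise
  rw [Real.coe_toNNReal _ (by linarith)] at h1 h2
  refine (measureReal_mono (?_ : _ ⊆ {ω | 8 * p * ((p : ℝ) - 1) ≤ ∑ j, rowNoise b zs Y j ω ^ 2} ∪
    {ω | 8 * p * ((p : ℝ) - 1) ≤ ∑ j, colNoise b zs Y j ω ^ 2})).trans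
    ((measureReal_union_le _ _).trans (by linarith))
  intro ω hω
  by_contra hc
  simp only [Set.mem_union, Set.mem_ofPred_eq, not_or, not_le] at hc
  refine hω ?_
  calc ∑ j, noise (fun i j => Y i j ω) b zs j ^ 2
      ≤ ∑ j, (2 * rowNoise b zs Y j ω ^ 2 + 2 * colNoise b zs Y j ω ^ 2) := by
        gcongr with j _
        rw [noise_eq]
        nlinarith [sq_nonneg (rowNoise b zs Y j ω + colNoise b zs Y j ω)]
    _ = 2 * ∑ j, rowNoise b zs Y j ω ^ 2 + 2 * ∑ j, colNoise b zs Y j ω ^ 2 := by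
        rw [Finset.sum_add_distrib, ← Finset.mul_sum, ← Finset.mul_sum]
    _ ≤ 32 * (p : ℝ) ^ 2 := by nlinarith

lemma IsPairwiseComparison.integrable_truncatedNoise (hp : 2 ≤ p)
    (h : IsPairwiseComparison P b zs Y) (u : ℝ) :
    Integrable (fun ω => truncatedNoise (fun i j => Y i j ω) b zs u) P := by
  exact (integrable_finsetSum _ fun j _ =>
    integrable_truncated_sq (h.hasLaw_noise hp j)).const_mul _

/-- The variance `2(p-1)` cancels the prefactor `8/(p-1)`. At `u ≈ p|b|` the exponent is close to
`-pb²/4`. -/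
lemma IsPairwiseComparison.integral_truncatedNoise_le (hp : 2 ≤ p)
    (h : IsPairwiseComparison P b zs Y) {u θ : ℝ} (hu : 0 ≤ u) (hθ : 0 < θ) (hθ' : θ ≤ 1 / 2) :
    ∫ ω, truncatedNoise (fun i j => Y i j ω) b zs u ∂P ≤
      p * (32 / θ * (√θ)⁻¹) * Real.exp (-(1 - 2 * θ) * u ^ 2 / (4 * p)) := by
  have hp' : (2 : ℝ) ≤ p := by exact_mod_cast hp
  have hp1 : (0 : ℝ) < p - 1 := by linarith
  have hv : (2 * ((p : ℝ) - 1)).toNNReal ≠ 0 := by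
    rw [Ne, Real.toNNReal_eq_zero]; linarith
  simp only [truncatedNoise]
  rw [integral_const_mul, integral_finsetSum _ fun j _ =>
    integrable_truncated_sq (h.hasLaw_noise hp j)]
  calc 8 / ((p : ℝ) - 1) * ∑ j, ∫ ω, (if u ≤ |noise (fun i j => Y i j ω) b zs j| then
          noise (fun i j => Y i j ω) b zs j ^ 2 else 0) ∂P
      ≤ 8 / ((p : ℝ) - 1) * ∑ _j : Fin p, (2 * (2 * ((p : ℝ) - 1)) / θ *
          Real.exp (-(1 - 2 * θ) * u ^ 2 / (2 * (2 * ((p : ℝ) - 1)))) * (√θ)⁻¹) := by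
        gcongr with j _
        have := integral_truncated_sq_le hv (h.hasLaw_noise hp j) hu hθ hθ'
        rwa [Real.coe_toNNReal _ (by linarith)] at this
    _ = p * (32 / θ * (√θ)⁻¹) * Real.exp (-((1 - 2 * θ) * u ^ 2 / (4 * ((p : ℝ) - 1)))) := by
        rw [Finset.sum_const, Finset.card_univ, Fintype.card_fin, nsmul_eq_mul,
          show -(1 - 2 * θ) * u ^ 2 / (2 * (2 * ((p : ℝ) - 1))) =
            -((1 - 2 * θ) * u ^ 2 / (4 * ((p : ℝ) - 1))) by ring]
        field_simp
        ring
    _ ≤ _ := by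
        rw [show -(1 - 2 * θ) * u ^ 2 / (4 * (p : ℝ)) = -((1 - 2 * θ) * u ^ 2 / (4 * (p : ℝ))) by
          ring]
        have : 0 ≤ 1 - 2 * θ := by linarith
        gcongr
        linarith

end Model

/-! ### The iterates -/

/-- The contraction guarantee with exponent `1 + δ` for `p` players. -/
def Guarantee.{u} (p : ℕ) (b c τ δ : ℝ) : Prop :=
  ∀ zstar ∈ approxPerm p c,
  ∀ (Ω : Type u) [MeasurableSpace Ω] (P : Measure Ω) [IsProbabilityMeasure P]
    (Y : Fin p → Fin p → Ω → ℝ) (z : ℕ → Ω → Fin p → ℕ) (η : ℝ),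
    IsPairwiseComparison P b zstar Y →
    (∀ t, Measurable (z t)) →
    (∀ ω, IsLabel (z 0 ω)) →
    (∀ t ω, IsStep (fun i j => Y i j ω) (z t ω) (z (t + 1) ω)) →
    1 - η ≤ P.real {ω | loss b (z 0 ω) zstar ≤ τ} →
    1 - η - Real.exp (-√((p : ℝ) * b ^ 2)) - 2 * (p : ℝ)⁻¹ ≤
      P.real {ω | ∀ t : ℕ, 1 ≤ t →
        loss b (z t ω) zstar ≤
          (p : ℝ) * Real.exp (-(1 + δ) * ((p : ℝ) * b ^ 2 / 4))
            + 1 / 2 * loss b (z (t - 1) ω) zstar}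

lemma loss_nonneg {p : ℕ} (hp : 2 ≤ p) (b : ℝ) (z zs : Fin p → ℕ) : 0 ≤ loss b z zs := by
  have hp' : (2 : ℝ) ≤ p := by exact_mod_cast hp
  have hp1 : (0 : ℝ) < p - 1 := by linarith
  rw [loss]
  positivity

lemma Guarantee.mono.{u} {p : ℕ} {b c τ δ δ' : ℝ} (hδ : δ' ≤ δ) (h : Guarantee.{u} p b c τ δ) :
    Guarantee.{u} p b c τ δ' := by
  intro zstar hz Ω _ P _ Y z η h1 h2 h3 h4 h5
  refine (h zstar hz Ω P Y z η h1 h2 h3 h4 h5).trans (measureReal_mono fun ω hω t ht => ?_)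
  refine (hω t ht).trans ?_
  gcongr

lemma sum_sub_sq_le_of_isLabel {p : ℕ} {z zs : Fin p → ℕ} (hz : IsLabel z) (hzs : IsLabel zs) :
    ∑ j, ((z j : ℝ) - zs j) ^ 2 ≤ (p : ℝ) ^ 3 := by
  calc ∑ j, ((z j : ℝ) - zs j) ^ 2 ≤ ∑ _j : Fin p, (p : ℝ) ^ 2 := by
        refine Finset.sum_le_sum fun j _ => sq_le_sq' ?_ ?_
        all_goals
          have h1 : (z j : ℝ) ≤ p := by exact_mod_cast (Finset.mem_Icc.1 (hz j)).2
          have h2 : (zs j : ℝ) ≤ p := by exact_mod_cast (Finset.mem_Icc.1 (hzs j)).2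
          have h3 : (0 : ℝ) ≤ z j := Nat.cast_nonneg _
          have h4 : (0 : ℝ) ≤ zs j := Nat.cast_nonneg _
          linarith
    _ = (p : ℝ) ^ 3 := by simp; ring

/-- For each fixed `p` the guarantee holds with a sufficiently small exponent. -/
lemma exists_guarantee {p : ℕ} (hp : 2 ≤ p) (b c τ : ℝ) :
    ∃ e : ℝ, 0 ≤ e ∧ Guarantee p b c τ (-e) := by
  have hp' : (2 : ℝ) ≤ p := by exact_mod_cast hp
  have hp1 : (0 : ℝ) < p - 1 := by linarith
  set M : ℝ := 2 * (p : ℝ) ^ 2 * b ^ 2 / ((p : ℝ) - 1) * (p : ℝ) ^ 3 with hM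
  have hM0 : 0 ≤ M := by positivity
  -- For `b ≠ 0` this makes the exponential term `p * exp M`, above the largest possible loss `M`.
  -- For `b = 0` the quotient is `0` by convention, and `M = 0`.
  refine ⟨1 + 4 * M / (p * b ^ 2), by positivity, ?_⟩
  intro zs hzs Ω _ P _ Y z η _ _ _ hstep hη
  have hle : M ≤ p * Real.exp (-(1 + -(1 + 4 * M / (p * b ^ 2))) * ((p : ℝ) * b ^ 2 / 4)) := by
    by_cases hb : b = 0
    · simp [hM, hb]
    · rw [show -(1 + -(1 + 4 * M / (p * b ^ 2))) * ((p : ℝ) * b ^ 2 / 4) = M by field_simp; ring]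
      nlinarith [Real.add_one_le_exp M]
  have huniv : (Set.univ : Set Ω) ⊆ {ω | ∀ t : ℕ, 1 ≤ t → loss b (z t ω) zs ≤
      (p : ℝ) * Real.exp (-(1 + -(1 + 4 * M / (p * b ^ 2))) * ((p : ℝ) * b ^ 2 / 4))
        + 1 / 2 * loss b (z (t - 1) ω) zs} := by
    intro ω _ t ht
    obtain ⟨s, rfl⟩ : ∃ s, t = s + 1 := ⟨t - 1, by lia⟩
    have h1 : loss b (z (s + 1) ω) zs ≤ M := by
      rw [loss, hM]
      gcongr
      exact sum_sub_sq_le_of_isLabel (fun j => (hstep s ω j).1) hzs.1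
    linarith [loss_nonneg hp b (z (s + 1 - 1) ω) zs]
  -- With `hη` this forces `η ≥ 0`.
  have h1 : P.real {ω | loss b (z 0 ω) zs ≤ τ} ≤ 1 := measureReal_le_one
  have h2 := measureReal_mono (μ := P) huniv
  rw [probReal_univ] at h2
  have h3 := Real.exp_pos (-√((p : ℝ) * b ^ 2))
  have h4 : (0 : ℝ) ≤ 2 * (p : ℝ)⁻¹ := by positivity
  linarith

lemma guarantee_of_le {p : ℕ} (hp : 2 ≤ p) {b c τ ρ θ ε : ℝ} (hρ0 : 0 < ρ) (hρ : ρ ≤ 1 / 12)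
    (hθ0 : 0 < θ) (hθ : θ ≤ 1 / 2) (hε : ε ≤ 1) (hb : b ≠ 0) (hc : c ≤ ρ ^ 2 / 256 * p)
    (hτ : τ ≤ ρ ^ 2 / 256 * (p ^ 2 * b ^ 2)) (hx : 131072 ≤ ρ ^ 2 * (p * b ^ 2))
    (hsmall : 32 / θ * (√θ)⁻¹ * Real.exp (-(1 - 2 * θ) * (1 - 3 * ρ) ^ 2 * (p * b ^ 2) / 4) *
      Real.exp (√(p * b ^ 2)) ≤ Real.exp (-(1 - ε) * (p * b ^ 2 / 4))) :
    Guarantee p b c τ (-ε) := by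
  intro zs hzs Ω _ P _ Y z η hY _ hz0 hstep hη
  obtain ⟨hlab, σ, hσ⟩ := hzs
  have hp' : (2 : ℝ) ≤ p := by exact_mod_cast hp
  have hp0 : (0 : ℝ) < p := by linarith
  have hp1 : (0 : ℝ) < p - 1 := by linarith
  have hb0 : 0 < |b| := abs_pos.2 hb
  -- Then the bias `128κ` is `ρ²/2`. The noise part `2048 * 32 / p³` fits in the other half because
  -- `131072 = 2 * 2048 * 32`.
  set κ := ρ ^ 2 / 256 with hκ
  have hκ0 : 0 < κ := by positivity
  have hκ1 : κ ≤ 1 / 64 := by rw [hκ]; nlinarith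
  replace hσ := hσ.trans hc
  have hpτ : p ≤ κ * (p ^ 2 * b ^ 2) := by
    have : 1 ≤ κ * (p * b ^ 2) := by rw [hκ]; linarith
    nlinarith
  set u := (1 - 3 * ρ) * (p * |b|) with hu
  have hu0 : 0 ≤ u := mul_nonneg (by linarith) (by positivity)
  set R := (p : ℝ) * Real.exp (-(1 + -ε) * ((p : ℝ) * b ^ 2 / 4)) with hR
  have hR0 : 0 < R := by positivity
  have hRp : R ≤ p := by
    refine mul_le_of_le_one_right hp0.le (Real.exp_le_one_iff.2 ?_)
    exact mul_nonpos_of_nonpos_of_nonneg (by linarith) (by positivity)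
  have hloss : ∀ ω t, ∑ j, noise (fun i j => Y i j ω) b zs j ^ 2 ≤ 32 * (p : ℝ) ^ 2 →
      IsLabel (z t ω) → loss b (z t ω) zs ≤ κ * (p ^ 2 * b ^ 2) →
      loss b (z (t + 1) ω) zs ≤ truncatedNoise (fun i j => Y i j ω) b zs u := by
    intro ω t hn hl hle
    have hd : ∑ j, ((z t ω j : ℝ) - zs j) ^ 2 ≤ κ * p := by
      rw [loss] at hle
      have h1 : 2 * (p : ℝ) ^ 2 * b ^ 2 / p * ∑ j, ((z t ω j : ℝ) - zs j) ^ 2 ≤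
          κ * (p ^ 2 * b ^ 2) := by
        refine le_trans ?_ hle
        gcongr
        linarith
      have h2 : 2 * (p : ℝ) ^ 2 * b ^ 2 / p = 2 * (p * b ^ 2) := by field_simp
      rw [h2] at h1
      have h3 : (p * b ^ 2) * ∑ j, ((z t ω j : ℝ) - zs j) ^ 2 ≤ (p * b ^ 2) * (κ * p) := by
        have : 0 ≤ (p * b ^ 2) * ∑ j, ((z t ω j : ℝ) - zs j) ^ 2 := by positivity
        linarith
      exact le_of_mul_le_mul_left h3 (by positivity)
    refine (hstep t ω).loss_le hp hρ0.le hρ hb (σ := σ) ?_ hlab ?_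
    · refine hσ.trans ?_
      rw [hκ]
      gcongr
      norm_num
    · refine abs_le_of_sq_le_sq ?_ (by positivity)
      refine (betaHat_sub_sq_le hp hκ1 hσ hl hd hn).trans ?_
      have h1 : 2048 * 32 / (p : ℝ) ^ 3 ≤ ρ ^ 2 / 2 * b ^ 2 / p ^ 2 := by
        rw [div_le_div_iff₀ (by positivity) (by positivity)]
        have : (0 : ℝ) < p ^ 2 := by positivity
        nlinarith
      calc _ ≤ 128 * κ * b ^ 2 / p ^ 2 + ρ ^ 2 / 2 * b ^ 2 / p ^ 2 := by gcongr
        _ = (ρ * |b| / p) ^ 2 := by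
          rw [div_pow, mul_pow, sq_abs, hκ]; ring
  have hmarkov : P.real {ω | R ≤ truncatedNoise (fun i j => Y i j ω) b zs u} ≤
      Real.exp (-√((p : ℝ) * b ^ 2)) := by
    have hnn : ∀ ω, 0 ≤ truncatedNoise (fun i j => Y i j ω) b zs u := fun ω => by
      refine mul_nonneg (by positivity) (Finset.sum_nonneg fun j _ => ?_)
      split_ifs <;> positivity
    have h1 := mul_meas_ge_le_integral_of_nonneg (ae_of_all P hnn)
      (hY.integrable_truncatedNoise hp u) R
    have h2 := hY.integral_truncatedNoise_le hp hu0 hθ0 hθ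
    have h3 : -(1 - 2 * θ) * u ^ 2 / (4 * p) =
        -(1 - 2 * θ) * (1 - 3 * ρ) ^ 2 * (p * b ^ 2) / 4 := by
      rw [hu, mul_pow, mul_pow, sq_abs]; field_simp
    rw [h3] at h2
    have h4 : p * (32 / θ * (√θ)⁻¹) *
        Real.exp (-(1 - 2 * θ) * (1 - 3 * ρ) ^ 2 * (p * b ^ 2) / 4) ≤
        R * Real.exp (-√((p : ℝ) * b ^ 2)) := by
      rw [Real.exp_neg (√_), ← div_eq_mul_inv R, le_div_iff₀ (Real.exp_pos _), hR]
      calc _ = p * (32 / θ * (√θ)⁻¹ *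
            Real.exp (-(1 - 2 * θ) * (1 - 3 * ρ) ^ 2 * (p * b ^ 2) / 4) *
            Real.exp (√(p * b ^ 2))) := by ring
        _ ≤ p * Real.exp (-(1 - ε) * (p * b ^ 2 / 4)) := by gcongr
        _ = _ := by rw [sub_eq_add_neg]
    exact le_of_mul_le_mul_left (h1.trans (h2.trans h4)) hR0
  have hsub : {ω | loss b (z 0 ω) zs ≤ τ} ⊆
      ({ω | ∀ t : ℕ, 1 ≤ t → loss b (z t ω) zs ≤ R + 1 / 2 * loss b (z (t - 1) ω) zs} ∪
        {ω | R ≤ truncatedNoise (fun i j => Y i j ω) b zs u}) ∪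
        {ω | ¬ ∑ j, noise (fun i j => Y i j ω) b zs j ^ 2 ≤ 32 * (p : ℝ) ^ 2} := by
    intro ω hω
    by_contra hcon
    simp only [Set.mem_union, Set.mem_ofPred_eq, not_or, not_le] at hcon hω
    obtain ⟨⟨hbad, htr⟩, hn⟩ := hcon
    replace hn := not_lt.1 hn
    refine hbad ?_
    have hl : ∀ t, IsLabel (z t ω) := fun t => by
      cases t with
      | zero => exact hz0 ω
      | succ s => exact fun j => (hstep s ω j).1
    -- The basin of accuracy is never left: after a step the loss is below `R ≤ p ≤ κp²b²`.
    have hind : ∀ t, loss b (z t ω) zs ≤ κ * (p ^ 2 * b ^ 2) := fun t => by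
      induction t with
      | zero => exact hω.trans hτ
      | succ s ih => exact (hloss ω s hn (hl s) ih).trans (htr.le.trans (hRp.trans hpτ))
    intro t ht
    obtain ⟨s, rfl⟩ : ∃ s, t = s + 1 := ⟨t - 1, by lia⟩
    have := hloss ω s hn (hl s) (hind s)
    linarith [loss_nonneg hp b (z (s + 1 - 1) ω) zs]
  have h1 := (measureReal_mono (μ := P) hsub).trans ((measureReal_union_le _ _).trans
    (add_le_add_left (measureReal_union_le _ _) _))
  linarith [hY.measureReal_noise_le hp]

/-! ### Passage to the limit and the choice of the `o(1)` sequence -/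

lemma exp_bound_of_sqrt_ge {x ε C : ℝ} (hx : 0 ≤ x) (hε0 : 0 < ε) (hε : ε ≤ 1) (h1 : 16 / ε ≤ √x)
    (h2 : C ≤ √x) :
    C * Real.exp (-(1 - 2 * (ε / 8)) * (1 - 3 * (ε / 24)) ^ 2 * x / 4) * Real.exp (√x) ≤
      Real.exp (-(1 - ε) * (x / 4)) := by
  have hC : C ≤ Real.exp (√x) := by linarith [Real.add_one_le_exp (√x)]
  calc _ ≤ Real.exp (√x) * Real.exp (-(1 - 2 * (ε / 8)) * (1 - 3 * (ε / 24)) ^ 2 * x / 4) *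
        Real.exp (√x) := by gcongr
    _ = Real.exp (√x + -(1 - 2 * (ε / 8)) * (1 - 3 * (ε / 24)) ^ 2 * x / 4 + √x) := by
        rw [Real.exp_add, Real.exp_add]
    _ ≤ _ := by
        refine Real.exp_le_exp.2 ?_
        -- Truncation and tilt lose at most `ε/2` of the exponent. The remaining `εx/8` pays for two
        -- terms `√x`: one bounds `C`, the other is the price of Markov's inequality.
        rw [div_le_iff₀ hε0] at h1
        have h3 : 16 * √x ≤ ε * x := by
          nlinarith [Real.mul_self_sqrt hx, Real.sqrt_nonneg x]
        have h4 : 1 - ε / 2 ≤ (1 - 2 * (ε / 8)) * (1 - 3 * (ε / 24)) ^ 2 := by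
          nlinarith [mul_nonneg hε0.le hε0.le, mul_nonneg (mul_nonneg hε0.le hε0.le)
            (sub_nonneg.2 hε)]
        nlinarith [mul_le_mul_of_nonneg_right h4 hx]

lemma eventually_guarantee {β c τ : ℕ → ℝ}
    (hβ : Tendsto (fun p : ℕ => (p : ℝ) * β p ^ 2) atTop atTop)
    (hc : c =o[atTop] fun p : ℕ => (p : ℝ))
    (hτ : τ =o[atTop] fun p : ℕ => (p : ℝ) ^ 2 * β p ^ 2) {ε : ℝ} (hε0 : 0 < ε) (hε : ε ≤ 1) :
    ∀ᶠ p in atTop, Guarantee p (β p) (c p) (τ p) (-ε) := by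
  have hκ : 0 < (ε / 24) ^ 2 / 256 := by positivity
  have hsqrt := Real.tendsto_sqrt_atTop.comp hβ
  filter_upwards [eventually_ge_atTop 2, hc.bound hκ, hτ.bound hκ,
    hβ.eventually_ge_atTop (131072 / (ε / 24) ^ 2),
    hsqrt.eventually_ge_atTop (16 / ε),
    hsqrt.eventually_ge_atTop (32 / (ε / 8) * (√(ε / 8))⁻¹)] with p hp hcp hτp hx h16 hC
  have hpos : 0 < (p : ℝ) * β p ^ 2 := lt_of_lt_of_le (by positivity) hx
  have hb : β p ≠ 0 := fun h => by simp [h] at hpos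
  rw [Real.norm_of_nonneg (by positivity : (0 : ℝ) ≤ p)] at hcp
  rw [Real.norm_of_nonneg (by positivity : (0 : ℝ) ≤ (p : ℝ) ^ 2 * β p ^ 2)] at hτp
  refine guarantee_of_le hp (ρ := ε / 24) (θ := ε / 8) (by positivity) (by linarith)
    (by positivity) (by linarith) hε hb ((le_abs_self _).trans hcp) ((le_abs_self _).trans hτp) ?_
    (exp_bound_of_sqrt_ge hpos.le hε0 hε h16 hC)
  rwa [div_le_iff₀' (by positivity)] at hx

/-- A monotone family of properties that holds eventually at each positive level holds along some
sequence of levels tending to zero. -/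
lemma exists_tendsto_zero_of_eventually {Q : ℕ → ℝ → Prop}
    (hmono : ∀ p e e', e ≤ e' → Q p e → Q p e') (hex : ∀ p, 2 ≤ p → ∃ e, 0 ≤ e ∧ Q p e)
    (hev : ∀ ε, 0 < ε → ε ≤ 1 → ∀ᶠ p in atTop, Q p ε) :
    ∃ e : ℕ → ℝ, Tendsto e atTop (𝓝 0) ∧ ∀ p, 2 ≤ p → Q p (e p) := by
  set s : ℕ → ℝ := fun p => sInf {e | 0 ≤ e ∧ Q p e} with hs
  have hs0 : ∀ p, 0 ≤ s p := fun p => Real.sInf_nonneg fun e he => he.1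
  have hst : Tendsto s atTop (𝓝 0) := by
    refine tendsto_order.2 ⟨fun a ha => Eventually.of_forall fun p => ha.trans_le (hs0 p),
      fun a ha => ?_⟩
    have ha' : 0 < min (a / 2) 1 := by positivity
    filter_upwards [hev _ ha' (min_le_right _ _)] with p hp
    have h1 : s p ≤ min (a / 2) 1 := csInf_le ⟨0, fun e he => he.1⟩ ⟨ha'.le, hp⟩
    linarith [min_le_left (a / 2) 1]
  -- The infimum need not be attained; the vanishing margin leaves an admissible level strictly
  -- below.
  refine ⟨fun p => s p + 1 / ((p : ℝ) + 1), ?_, fun p hp => ?_⟩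
  · simpa using hst.add tendsto_one_div_add_atTop_nhds_zero_nat
  · obtain ⟨e, ⟨-, he⟩, hlt⟩ := exists_lt_of_csInf_lt (hex p hp)
      (lt_add_of_pos_right (s p) (by positivity : (0 : ℝ) < 1 / ((p : ℝ) + 1)))
    exact hmono p e _ hlt.le he

end ApproxRanking

theorem theorem3
    (β c τ : ℕ → ℝ)
    (hβ : Tendsto (fun p : ℕ => (p : ℝ) * β p ^ 2) atTop atTop)
    (hc_one : ∀ p, 1 ≤ c p)
    (hc : c =o[atTop] fun p : ℕ => (p : ℝ))
    (hτ : τ =o[atTop] fun p : ℕ => (p : ℝ) ^ 2 * β p ^ 2) :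
    ∃ δ : ℕ → ℝ, Tendsto δ atTop (𝓝 0) ∧
      ∀ p : ℕ, 2 ≤ p →
      ∀ zstar ∈ ApproxRanking.approxPerm p (c p),
      ∀ (Ω : Type*) [MeasurableSpace Ω] (P : Measure Ω) [IsProbabilityMeasure P]
        (Y : Fin p → Fin p → Ω → ℝ) (z : ℕ → Ω → Fin p → ℕ) (η : ℝ),
        ApproxRanking.IsPairwiseComparison P (β p) zstar Y →
        (∀ t, Measurable (z t)) →
        (∀ ω, ApproxRanking.IsLabel (z 0 ω)) →
        (∀ t ω, ApproxRanking.IsStep (fun i j => Y i j ω) (z t ω) (z (t + 1) ω)) →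
        1 - η ≤ P.real {ω | ApproxRanking.loss (β p) (z 0 ω) zstar ≤ τ p} →
        1 - η - Real.exp (-√((p : ℝ) * β p ^ 2)) - 2 * (p : ℝ)⁻¹ ≤
          P.real {ω | ∀ t : ℕ, 1 ≤ t →
            ApproxRanking.loss (β p) (z t ω) zstar ≤
              (p : ℝ) * Real.exp (-(1 + δ p) * ((p : ℝ) * β p ^ 2 / 4))
                + 1 / 2 * ApproxRanking.loss (β p) (z (t - 1) ω) zstar} := by
  -- `Guarantee` quantifies over `z*`, the probability space and the iterates, so the level depends
  -- only on `β`, `c` and `τ`.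
  obtain ⟨e, he, hQ⟩ := ApproxRanking.exists_tendsto_zero_of_eventually
    (Q := fun p e => ApproxRanking.Guarantee p (β p) (c p) (τ p) (-e))
    (fun _ _ _ h => ApproxRanking.Guarantee.mono (neg_le_neg h))
    (fun p hp => ApproxRanking.exists_guarantee hp (β p) (c p) (τ p))
    (fun _ h0 h1 => ApproxRanking.eventually_guarantee hβ hc hτ h0 h1)
  exact ⟨fun p => -e p, by simpa using he.neg, hQ⟩
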